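/- Let $\omega_1,\omega_2\subset\mathbb C$ be the open disks with centres $z_1,z_2$ and radii $\rho_1,\rho_2>0$, with disjoint closures, i.e. $\rho:=|z_1-z_2|>\rho_1+\rho_2$, and let $\gamma_j=\partial\omega_j$. For $j\in\{1,2\}$ write $k=3-j$ for the other index, and put $\Lambda_j=(\rho_j/\rho)^2$. Define real numbers $\lambda_{j,n}$ ($n\ge 0$) by the continued-fraction recursion $$\lambda_{j,0}=1,\qquad \lambda_{j,n}=1-\frac{\Lambda_k}{\lambda_{k,n-1}}\quad(n\ge 1),$$ points $z_{j,n}$ ($n\ge 0$) by $$z_{j,n}=(1-\lambda_{k,n})z_k+\lambda_{k,n}z_j,$$ and complex numbers $\kappa_{j,n},\alpha_{j,n}$ ($n\ge1$) by $$\kappa_{j,1}=2\rho_k^2,\qquad \kappa_{j,2}=-\frac{2(\rho_j\rho_k)^2}{(\overline{z_k-z_j})^2},\qquad \kappa_{j,n+2}=\frac{\Lambda_j\Lambda_k}{(\lambda_{k,n}\lambda_{j,n-1})^2}\,\kappa_{j,n}\quad(n\ge1),$$ $$\alpha_{j,n}=-\frac12\,\frac{\kappa_{j,n}}{\lambda_{j,n-1}(z_j-z_k)}\quad(n\ge1).$$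 Finally define densities on $\gamma_j$ by $$q_{j,0}(x)=2(x-z_j),\qquad q_{j,n}(x)=\frac{\kappa_{j,n}}{x-z_{k,n-1}}+\alpha_{j,n}\quad(n\ge1).$$ Then: 1. $z_{j,n}\in\omega_j$ for $j=1,2$ and all $n\ge0$. 2. For $j=1,2$ the series $\sum_{n\ge0}\bigl(q_{j,2n}+\overline{q_{j,2n+1}}\bigr)$ converges in $H^{1/2}(\gamma_j)$ to a limit $q_j\in H^{1/2}(\gamma_j)$. 3. These limits satisfy, for $j=1,2$, $$\mathscr D_{\gamma_1}q_1(\xi)+\mathscr D_{\gamma_2}q_2(\xi)=\xi-z_j\qquad\text{for all }\xi\in\omega_j.$$ Here $\mathscr D_{\gamma_j}q(x)=\int_{\gamma_j}\partial_{n_y}G(x-y)\,q(y)\,\mathrm d\sigma_y$ for $x\notin\gamma_j$ is the double layer potential, with $G(x)=-\frac1{2\pi}\log|x|$, $n$ the unit normal to $\gamma_j$ pointing into $\omega_j$, and $\sigma$ arc length; $H^{1/2}(\gamma_j)$ is the space of complex-valued densities on $\gamma_j$ with finite norm $\|q\|^2=\int_{\gamma_j}|q|^2\,\mathrm d\sigma+\iint_{\gamma_j\times\gamma_j}\frac{|q(x)-q(y)|^2}{|x-y|^2}\,\mathrm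 d\sigma_x\,\mathrm d\sigma_y$. -/

import Mathlib

open scoped ENNReal ComplexConjugate

noncomputable section

namespace TwoDisks

/-! ### Boundary circles, arc length, and the space `H^{1/2}` -/

/-- Arc-length measure on the circle with centre `c` and radius `R`, as a measure on `ℂ`:
`R dθ` pushed forward by `θ ↦ c + R e^{iθ}`, for `0 < θ ≤ 2π`. -/
def arcLength (c : ℂ) (R : ℝ) : MeasureTheory.Measure ℂ :=
  ENNReal.ofReal R •
    (MeasureTheory.volume.restrict (Set.Ioc (0 : ℝ) (2 * Real.pi))).map (circleMap c R)

/-- The Sobolev-Slobodeckij norm of `H^{1/2}` of the circle, with values in `[0, ∞]`: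
`‖f‖² = ∫ |f(x)|² dσ_x + ∬ |f(x) - f(y)|² / |x - y|² dσ_y dσ_x`.
Only the values of `f` on the circle matter. -/
def hHalfNorm (c : ℂ) (R : ℝ) (f : ℂ → ℂ) : ℝ≥0∞ :=
  ((∫⁻ x, ‖f x‖ₑ ^ 2 ∂(arcLength c R)) +
    ∫⁻ x, ∫⁻ y, (‖f x - f y‖ₑ / ‖x - y‖ₑ) ^ 2 ∂(arcLength c R) ∂(arcLength c R)) ^ (1 / 2 : ℝ)

/-- `f` (a representative of a complex-valued density on the circle) belongs to `H^{1/2}`. -/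
def MemHHalf (c : ℂ) (R : ℝ) (f : ℂ → ℂ) : Prop :=
  MeasureTheory.AEStronglyMeasurable f (arcLength c R) ∧ hHalfNorm c R f < ∞

/-- The sequence `s` of densities converges to `f` in `H^{1/2}` of the circle. -/
def TendstoHHalf (c : ℂ) (R : ℝ) (s : ℕ → ℂ → ℂ) (f : ℂ → ℂ) : Prop :=
  (∀ N, MemHHalf c R (s N)) ∧ MemHHalf c R f ∧
    Filter.Tendsto (fun N => hHalfNorm c R (fun x => s N x - f x)) Filter.atTop (nhds 0)

/-! ### The double layer potential -/

/-- The fundamental solution `G(x) = -(1/2π) log |x|` of `-Δ` in the plane. -/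
def fundSol (x : ℂ) : ℝ := -(1 / (2 * Real.pi)) * Real.log ‖x‖

/-- The unit normal at the point `y` of the circle, pointing into the disk (the exterior
direction for the domain outside the disks). -/
def unitNormal (c : ℂ) (R : ℝ) (y : ℂ) : ℂ := (c - y) / R

/-- The double layer potential `D_γ q(x) = ∫_γ ∂_{n_y} G(x - y) q(y) dσ_y` on the circle `γ` with
centre `c` and radius `R`; here `∂_{n_y} G(x - y)` is the derivative of `y ↦ G(x - y)` in the
direction of the unit normal at `y`. -/
def doubleLayer (c : ℂ) (R : ℝ) (q : ℂ → ℂ) (x : ℂ) : ℂ :=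
  ∫ y, ((fderiv ℝ (fun w => fundSol (x - w)) y (unitNormal c R y) : ℝ) : ℂ) * q y
    ∂(arcLength c R)

/-! ### The explicit sequences

The two disks are indexed by `Fin 2`; if `j` is one index, then `1 - j` is the other one.
The centres are `z 0`, `z 1` and the radii are `ρ 0`, `ρ 1`. -/

/-- `Λ_j = (ρ_j / |z_0 - z_1|)²`. -/
def bigLam (z : Fin 2 → ℂ) (ρ : Fin 2 → ℝ) (j : Fin 2) : ℝ := (ρ j / ‖z 0 - z 1‖) ^ 2

/-- The continued-fraction recursion: `λ_{j,0} = 1` and `λ_{j,n} = 1 - Λ_k / λ_{k,n-1}` for `n ≥ 1`,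
where `k` is the other index. -/
def lam (z : Fin 2 → ℂ) (ρ : Fin 2 → ℝ) : Fin 2 → ℕ → ℝ
  | _, 0 => 1
  | j, n + 1 => 1 - bigLam z ρ (1 - j) / lam z ρ (1 - j) n

/-- The points `z_{j,n} = (1 - λ_{k,n}) z_k + λ_{k,n} z_j`, where `k` is the other index. -/
def pt (z : Fin 2 → ℂ) (ρ : Fin 2 → ℝ) (j : Fin 2) (n : ℕ) : ℂ :=
  (1 - (lam z ρ (1 - j) n : ℂ)) * z (1 - j) + (lam z ρ (1 - j) n : ℂ) * z j

/-- The coefficients `κ_{j,n}`, `n ≥ 1` (the value at `n = 0` is a dummy, never used): with `k` the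
other index, `κ_{j,1} = 2 ρ_k²`, `κ_{j,2} = -2 (ρ_j ρ_k)² / conj(z_k - z_j)²` and
`κ_{j,n+2} = Λ_j Λ_k / (λ_{k,n} λ_{j,n-1})² κ_{j,n}` for `n ≥ 1`. -/
def kap (z : Fin 2 → ℂ) (ρ : Fin 2 → ℝ) (j : Fin 2) : ℕ → ℂ
  | 0 => 0
  | 1 => 2 * (ρ (1 - j) : ℂ) ^ 2
  | 2 => -(2 * ((ρ j : ℂ) * (ρ (1 - j) : ℂ)) ^ 2 / (conj (z (1 - j) - z j)) ^ 2)
  | n + 3 =>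
      ((bigLam z ρ j * bigLam z ρ (1 - j) / (lam z ρ (1 - j) (n + 1) * lam z ρ j n) ^ 2 : ℝ) : ℂ)
        * kap z ρ j (n + 1)

/-- The coefficients `α_{j,n} = -(1/2) κ_{j,n} / (λ_{j,n-1} (z_j - z_k))`, `n ≥ 1`, where `k` is the
other index (the value at `n = 0` is a dummy, never used). -/
def alp (z : Fin 2 → ℂ) (ρ : Fin 2 → ℝ) (j : Fin 2) : ℕ → ℂ
  | 0 => 0
  | n + 1 => -(1 / 2) * (kap z ρ j (n + 1) / ((lam z ρ j n : ℂ) * (z j - z (1 - j))))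

/-- The densities: `q_{j,0}(x) = 2 (x - z_j)` and `q_{j,n}(x) = κ_{j,n} / (x - z_{k,n-1}) + α_{j,n}`
for `n ≥ 1`, where `k` is the other index. -/
def dens (z : Fin 2 → ℂ) (ρ : Fin 2 → ℝ) (j : Fin 2) : ℕ → ℂ → ℂ
  | 0, x => 2 * (x - z j)
  | n + 1, x => kap z ρ j (n + 1) / (x - pt z ρ (1 - j) n) + alp z ρ j (n + 1)

end TwoDisks

end

/-! The proof is a method of images. On a circle with centre `c` the double layer kernel is a real
part of a Cauchy kernel, so for `f` holomorphic in the disk and continuous up to the circle the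
potential is explicit: `(f x + f c) / 2` inside (`doubleLayer_of_mem_ball`) and `(f c - f x*) / 2`
outside (`doubleLayer_of_notMem_closedBall`), where `x*` is the reflection of `x` in the circle. The
kernel is real, so conjugate densities give conjugate potentials.

Every density `q_{j,n}` is holomorphic near the closed disk `j`, since its pole lies in the other
disk. The sequences are designed so that, for `x` in disk `j` and `x*` its reflection in circle `k`,
`conj (q_{j,n+1}(x) + q_{j,n+1}(z_j)) = q_{k,n}(x*) - q_{k,n}(z_k)` (`conj_dens_succ_add`). Hence
each term on circle `j` cancels the field that the preceding term on circle `k` produces in disk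
`j`. Only `q_{j,0}` has no predecessor, and it contributes `(2 (x - z_j) + 0) / 2 = x - z_j`.

Convergence rests on geometric decay of `κ_{j,n}` (`exists_norm_kap_le`) and on the positive gap
between the disks, which keeps the poles uniformly away. The resulting summable sup and Lipschitz
bounds imply convergence in `H^{1/2}`. -/

namespace TwoDisks

open MeasureTheory Metric Filter Topology

/-! ### Arc length -/

theorem arcLength_univ (c : ℂ) (R : ℝ) :
    arcLength c R Set.univ = ENNReal.ofReal R * ENNReal.ofReal (2 * Real.pi) := by
  simp [arcLength, Measure.map_apply (measurable_circleMap c R) MeasurableSet.univ]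

instance isFiniteMeasure_arcLength (c : ℂ) (R : ℝ) : IsFiniteMeasure (arcLength c R) :=
  ⟨by rw [arcLength_univ]; exact ENNReal.mul_lt_top ENNReal.ofReal_lt_top ENNReal.ofReal_lt_top⟩

theorem ae_map_circleMap_mem_sphere (c : ℂ) {R : ℝ} (hR : 0 < R) (μ : Measure ℝ) :
    ∀ᵐ x ∂(μ.map (circleMap c R)), x ∈ sphere c R :=
  (ae_map_iff (p := (· ∈ sphere c R)) (measurable_circleMap c R).aemeasurable
    isClosed_sphere.measurableSet).2 (Eventually.of_forall fun θ => circleMap_mem_sphere c hR.le θ)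

theorem ae_arcLength_mem_sphere (c : ℂ) {R : ℝ} (hR : 0 < R) :
    ∀ᵐ x ∂(arcLength c R), x ∈ sphere c R :=
  Measure.ae_smul_measure (ae_map_circleMap_mem_sphere c hR _) _

theorem aestronglyMeasurable_map_circleMap {c : ℂ} {R : ℝ} (hR : 0 < R) {f : ℂ → ℂ}
    (hf : ContinuousOn f (sphere c R)) (μ : Measure ℝ) :
    AEStronglyMeasurable f (μ.map (circleMap c R)) := by
  rw [← Measure.restrict_eq_self_of_ae_mem (ae_map_circleMap_mem_sphere c hR μ)]
  exact hf.aestronglyMeasurable isClosed_sphere.measurableSet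

theorem aestronglyMeasurable_arcLength {c : ℂ} {R : ℝ} (hR : 0 < R) {f : ℂ → ℂ}
    (hf : ContinuousOn f (sphere c R)) : AEStronglyMeasurable f (arcLength c R) :=
  (aestronglyMeasurable_map_circleMap hR hf _).smul_measure _

theorem integral_arcLength {c : ℂ} {R : ℝ} (hR : 0 < R) {f : ℂ → ℂ}
    (hf : ContinuousOn f (sphere c R)) :
    ∫ x, f x ∂(arcLength c R) = (2 * Real.pi * R : ℝ) • Real.circleAverage f c R := by
  rw [arcLength, integral_smul_measure, integral_map (measurable_circleMap c R).aemeasurable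
      (aestronglyMeasurable_map_circleMap hR hf _),
    Real.circleAverage, intervalIntegral.integral_of_le Real.two_pi_pos.le,
    ENNReal.toReal_ofReal hR.le, smul_smul]
  congr 1
  field_simp

/-! ### Sufficient conditions for convergence in `H^{1/2}` -/

/-- A Lipschitz bound makes the difference quotient in the double integral bounded, and arc length
is a finite measure. This replaces any finer analysis of `H^{1/2}`. -/
theorem hHalfNorm_le {c : ℂ} {R : ℝ} (hR : 0 < R) {f : ℂ → ℂ} {A : ℝ}
    (hb : ∀ x ∈ sphere c R, ‖f x‖ ≤ A)
    (hl : ∀ x ∈ sphere c R, ∀ y ∈ sphere c R, ‖f x - f y‖ ≤ A * ‖x - y‖) :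
    hHalfNorm c R f ≤ (ENNReal.ofReal A ^ 2 *
      (arcLength c R Set.univ + arcLength c R Set.univ * arcLength c R Set.univ)) ^ (1 / 2 : ℝ) := by
  have hae := ae_arcLength_mem_sphere c hR
  refine ENNReal.rpow_le_rpow ?_ (by norm_num)
  rw [mul_add]
  refine add_le_add ?_ ?_
  · rw [← lintegral_const]
    refine lintegral_mono_ae ?_
    filter_upwards [hae] with x hx
    rw [← ofReal_norm]
    gcongr
    exact hb x hx
  · rw [← mul_assoc, ← lintegral_const, ← lintegral_const]
    refine lintegral_mono_ae ?_
    filter_upwards [hae] with x hx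
    rw [lintegral_const, ← lintegral_const]
    refine lintegral_mono_ae ?_
    filter_upwards [hae] with y hy
    gcongr
    -- This form also covers the diagonal `x = y`, where the quotient is `0 / 0` in `ℝ≥0∞`.
    refine ENNReal.div_le_of_le_mul ?_
    rw [← ofReal_norm, ← ofReal_norm, ← ENNReal.ofReal_mul']
    · exact ENNReal.ofReal_le_ofReal (hl x hx y hy)
    · exact norm_nonneg _

theorem continuousOn_of_norm_sub_le {s : Set ℂ} {f : ℂ → ℂ} {A : ℝ}
    (hl : ∀ x ∈ s, ∀ y ∈ s, ‖f x - f y‖ ≤ A * ‖x - y‖) : ContinuousOn f s := by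
  refine (LipschitzOnWith.of_dist_le_mul (K := A.toNNReal) fun x hx y hy => ?_).continuousOn
  rw [dist_eq_norm, dist_eq_norm]
  exact (hl x hx y hy).trans (by gcongr; exact Real.le_coe_toNNReal A)

theorem memHHalf_of_norm_le {c : ℂ} {R : ℝ} (hR : 0 < R) {f : ℂ → ℂ} {A : ℝ}
    (hb : ∀ x ∈ sphere c R, ‖f x‖ ≤ A)
    (hl : ∀ x ∈ sphere c R, ∀ y ∈ sphere c R, ‖f x - f y‖ ≤ A * ‖x - y‖) : MemHHalf c R f := by
  refine ⟨aestronglyMeasurable_arcLength hR (continuousOn_of_norm_sub_le hl),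
    (hHalfNorm_le hR hb hl).trans_lt (ENNReal.rpow_lt_top_of_nonneg (by norm_num) ?_)⟩
  have := measure_ne_top (arcLength c R) Set.univ
  finiteness

/-! ### Series with summable sup and Lipschitz bounds. -/

section Series

variable {s : Set ℂ} {g : ℕ → ℂ → ℂ} {v : ℕ → ℝ}

theorem norm_tsum_le_of_forall (hv : Summable v) (hb : ∀ n, ∀ x ∈ s, ‖g n x‖ ≤ v n)
    (x : ℂ) (hx : x ∈ s) : ‖∑' n, g n x‖ ≤ ∑' n, v n :=
  tsum_of_norm_bounded hv.hasSum fun n => hb n x hx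

theorem norm_tsum_sub_tsum_le_of_forall (hv : Summable v) (hb : ∀ n, ∀ x ∈ s, ‖g n x‖ ≤ v n)
    (hl : ∀ n, ∀ x ∈ s, ∀ y ∈ s, ‖g n x - g n y‖ ≤ v n * ‖x - y‖)
    (x : ℂ) (hx : x ∈ s) (y : ℂ) (hy : y ∈ s) :
    ‖∑' n, g n x - ∑' n, g n y‖ ≤ (∑' n, v n) * ‖x - y‖ := by
  rw [← (Summable.of_norm_bounded hv (hb · x hx)).tsum_sub (.of_norm_bounded hv (hb · y hy)),
    ← tsum_mul_right]
  exact tsum_of_norm_bounded (hv.mul_right _).hasSum fun n => hl n x hx y hy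

theorem tendstoHHalf_tsum {c : ℂ} {R : ℝ} (hR : 0 < R) (hv : Summable v)
    (hb : ∀ n, ∀ x ∈ sphere c R, ‖g n x‖ ≤ v n)
    (hl : ∀ n, ∀ x ∈ sphere c R, ∀ y ∈ sphere c R, ‖g n x - g n y‖ ≤ v n * ‖x - y‖) :
    TendstoHHalf c R (fun N x => ∑ n ∈ Finset.range N, g n x) (fun x => ∑' n, g n x) := by
  refine ⟨fun N => memHHalf_of_norm_le hR (A := ∑ n ∈ Finset.range N, v n)
    (fun x hx => norm_sum_le_of_le _ fun n _ => hb n x hx) fun x hx y hy => ?_,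
    memHHalf_of_norm_le hR (norm_tsum_le_of_forall hv hb)
      (norm_tsum_sub_tsum_le_of_forall hv hb hl), ?_⟩
  · rw [← Finset.sum_sub_distrib, Finset.sum_mul]
    exact norm_sum_le_of_le _ fun n _ => hl n x hx y hy
  -- The error is minus the tail of the series, which obeys the same two bounds with the tail of
  -- `v`; these tail sums tend to `0`.
  have key : ∀ N, ∀ x ∈ sphere c R,
      ∑ n ∈ Finset.range N, g n x - ∑' n, g n x = -∑' n, g (n + N) x := fun N x hx => by
    rw [← (Summable.of_norm_bounded hv (hb · x hx)).sum_add_tsum_nat_add N]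
    ring
  have hv' : ∀ N, Summable fun n => v (n + N) := fun N => (summable_nat_add_iff N).2 hv
  have lim : Tendsto (fun N => (ENNReal.ofReal (∑' n, v (n + N)) ^ 2 *
      (arcLength c R Set.univ + arcLength c R Set.univ * arcLength c R Set.univ)) ^ (1 / 2 : ℝ))
      atTop (𝓝 0) := by
    have h0 := ENNReal.tendsto_ofReal (_root_.tendsto_sum_nat_add v)
    have h1 := (ENNReal.continuous_pow 2).tendsto _ |>.comp h0
    have hfin : arcLength c R Set.univ + arcLength c R Set.univ * arcLength c R Set.univ ≠ ∞ := by
      have := measure_ne_top (arcLength c R) Set.univ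
      finiteness
    have h2 := ENNReal.Tendsto.mul_const h1 (Or.inr hfin)
    have h3 := (ENNReal.continuous_rpow_const (y := 1 / 2)).tendsto _ |>.comp h2
    simpa [Function.comp_def] using h3
  refine tendsto_of_tendsto_of_tendsto_of_le_of_le tendsto_const_nhds lim
    (fun _ => zero_le) fun N => hHalfNorm_le hR (fun x hx => ?_) fun x hx y hy => ?_
  · simp only [key N x hx, norm_neg]
    exact norm_tsum_le_of_forall (hv' N) (fun n => hb (n + N)) x hx
  · simp only [key N x hx, key N y hy, neg_sub_neg]
    rw [norm_sub_rev]
    exact norm_tsum_sub_tsum_le_of_forall (hv' N) (fun n => hb (n + N)) (fun n => hl (n + N)) x hx y hy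

end Series

/-! ### The double layer potential of holomorphic and antiholomorphic densities -/

theorem fderiv_fundSol {x y : ℂ} (h : y ≠ x) (v : ℂ) :
    fderiv ℝ (fun w => fundSol (x - w)) y v = -(1 / (2 * Real.pi)) * (v / (y - x)).re := by
  have h1 : HasFDerivAt (fun w : ℂ => x - w) (-(ContinuousLinearMap.id ℝ ℂ)) y :=
    (hasFDerivAt_id y).const_sub x
  have hn : ‖x - y‖ ^ 2 ≠ 0 := by simpa [sub_eq_zero] using h.symm
  have h2 := ((h1.norm_sq.log hn).const_mul (1 / 2)).const_mul (-(1 / (2 * Real.pi)))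
  have h3 : (fun w => fundSol (x - w)) =
      fun w => -(1 / (2 * Real.pi)) * (1 / 2 * Real.log (‖x - w‖ ^ 2)) := by
    ext w
    simp [fundSol, Real.log_pow]
  rw [h3, h2.fderiv]
  have h4 : ‖x - y‖ ^ 2 = Complex.normSq (y - x) := by
    rw [norm_sub_rev, Complex.normSq_eq_norm_sq]
  simp only [h4, smul_apply, ContinuousLinearMap.comp_apply,
    neg_apply, innerSL_apply_apply, Complex.inner, smul_eq_mul,
    Complex.div_re, nsmul_eq_mul]
  simp
  ring

theorem continuousOn_doubleLayer_kernel {c x : ℂ} {R : ℝ} (hx : x ∉ sphere c R) {q : ℂ → ℂ}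
    (hq : ContinuousOn q (sphere c R)) :
    ContinuousOn (fun y => (((y - c) / (y - x)).re : ℂ) * q y) (sphere c R) := by
  have hne : ∀ y ∈ sphere c R, y - x ≠ 0 := fun y hy h => hx (sub_eq_zero.1 h ▸ hy)
  exact ContinuousOn.mul (Complex.continuous_ofReal.comp_continuousOn
      (Complex.continuous_re.comp_continuousOn (ContinuousOn.div (by fun_prop) (by fun_prop) hne))) hq

/-- The factor `2πR` from arc length cancels the constants of the kernel, and the inward normal
cancels the minus sign of `G`. -/
theorem doubleLayer_eq_circleAverage {c x : ℂ} {R : ℝ} (hR : 0 < R) {q : ℂ → ℂ}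
    (hq : ContinuousOn q (sphere c R)) (hx : x ∉ sphere c R) :
    doubleLayer c R q x =
      Real.circleAverage (fun y => (((y - c) / (y - x)).re : ℂ) * q y) c R := by
  have hne : ∀ y ∈ sphere c R, y - x ≠ 0 := fun y hy h => hx (sub_eq_zero.1 h ▸ hy)
  have hcongr : doubleLayer c R q x = ∫ y, (1 / (2 * Real.pi * R) : ℝ) •
      ((((y - c) / (y - x)).re : ℂ) * q y) ∂(arcLength c R) := by
    refine integral_congr_ae ?_
    filter_upwards [ae_arcLength_mem_sphere c hR] with y hy
    rw [fderiv_fundSol (sub_ne_zero.1 (hne y hy)), unitNormal, div_right_comm, Complex.div_ofReal_re,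
      ← neg_sub y c, neg_div, Complex.neg_re, Complex.real_smul, ← mul_assoc, ← Complex.ofReal_mul]
    congr 2
    field_simp
  rw [hcongr, integral_smul, integral_arcLength hR (continuousOn_doubleLayer_kernel hx hq), smul_smul, one_div_mul_cancel, one_smul]
  positivity

theorem doubleLayer_conj (c x : ℂ) (R : ℝ) (q : ℂ → ℂ) :
    doubleLayer c R (fun y => conj (q y)) x = conj (doubleLayer c R q x) := by
  rw [doubleLayer, doubleLayer, ← integral_conj]
  simp

theorem doubleLayer_add {c x : ℂ} {R : ℝ} (hR : 0 < R) {f g : ℂ → ℂ}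
    (hf : ContinuousOn f (sphere c R)) (hg : ContinuousOn g (sphere c R)) (hx : x ∉ sphere c R) :
    doubleLayer c R (fun y => f y + g y) x = doubleLayer c R f x + doubleLayer c R g x := by
  rw [doubleLayer_eq_circleAverage hR hf hx, doubleLayer_eq_circleAverage hR hg hx,
    doubleLayer_eq_circleAverage hR (hf.fun_add hg) hx, ← Real.circleAverage_fun_add
    ((continuousOn_doubleLayer_kernel hx hf).circleIntegrable hR.le)
    ((continuousOn_doubleLayer_kernel hx hg).circleIntegrable hR.le)]
  simp only [mul_add]

theorem doubleLayer_congr {c x : ℂ} {R : ℝ} (hR : 0 < R) {f g : ℂ → ℂ}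
    (h : Set.EqOn f g (sphere c R)) : doubleLayer c R f x = doubleLayer c R g x := by
  refine integral_congr_ae ?_
  filter_upwards [ae_arcLength_mem_sphere c hR] with y hy
  rw [h hy]

/-- Reflection in the circle of centre `c` and radius `R`. -/
noncomputable def reflect (c : ℂ) (R : ℝ) (x : ℂ) : ℂ := c + R ^ 2 / conj (x - c)

theorem reflect_mem_ball {c x : ℂ} {R : ℝ} (hR : 0 < R) (hx : x ∉ closedBall c R) :
    reflect c R x ∈ ball c R := by
  rw [mem_closedBall, not_le, dist_eq_norm] at hx
  rw [mem_ball, dist_eq_norm, reflect, add_sub_cancel_left, norm_div, norm_pow, Complex.norm_real,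
    RCLike.norm_conj, Real.norm_of_nonneg hR.le, div_lt_iff₀ (hR.trans hx)]
  nlinarith

theorem conj_sub_of_mem_sphere {c y : ℂ} {R : ℝ} (hy : y ∈ sphere c R) :
    (y - c) * conj (y - c) = R ^ 2 := by
  rw [Complex.mul_conj, Complex.normSq_eq_norm_sq, mem_sphere_iff_norm.1 hy]
  simp

/-- The real part is half the sum of `(y - c) / (y - x)` and its conjugate. The first averages to `f
x` by Cauchy's formula. The second agrees on the circle with a function holomorphic in the disk and
equal to `1` at `c`, so the mean value property gives `f c`. -/
theorem doubleLayer_of_mem_ball {c x : ℂ} {R : ℝ} (hR : 0 < R) {f : ℂ → ℂ}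
    (hf : DiffContOnCl ℂ f (ball c R)) (hx : x ∈ ball c R) :
    doubleLayer c R f x = (f x + f c) / 2 := by
  have hR' : |R| = R := abs_of_pos hR
  have hxs : x ∉ sphere c R := fun h => (mem_ball.1 hx).ne (mem_sphere.1 h)
  have hfs : ContinuousOn f (sphere c R) := hf.continuousOn_ball.mono sphere_subset_closedBall
  have hne : ∀ y ∈ sphere c R, y - x ≠ 0 := fun y hy h => hxs (sub_eq_zero.1 h ▸ hy)
  -- on the circle, the conjugate of the Cauchy kernel extends holomorphically
  have hden : ∀ y ∈ closedBall c R, (R : ℂ) ^ 2 - conj (x - c) * (y - c) ≠ 0 := fun y hy h => by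
    have h1 : ‖(R : ℂ) ^ 2‖ = ‖conj (x - c) * (y - c)‖ := by rw [sub_eq_zero.1 h]
    rw [norm_pow, Complex.norm_real, norm_mul, RCLike.norm_conj, Real.norm_of_nonneg hR.le] at h1
    rw [mem_ball, dist_eq_norm] at hx
    rw [mem_closedBall, dist_eq_norm] at hy
    nlinarith [norm_nonneg (x - c), norm_nonneg (y - c)]
  set h : ℂ → ℂ := fun y => (R : ℂ) ^ 2 / ((R : ℂ) ^ 2 - conj (x - c) * (y - c)) * f y with hh
  have hd : DiffContOnCl ℂ h (ball c R) := by
    have : DifferentiableOn ℂ (fun y => (R : ℂ) ^ 2 / ((R : ℂ) ^ 2 - conj (x - c) * (y - c)))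
        (closedBall c R) := DifferentiableOn.div (by fun_prop) (by fun_prop) hden
    rw [← closure_ball c hR.ne'] at this
    exact this.diffContOnCl.smul hf
  have hcauchy := DiffContOnCl.circleAverage_smul_div (f := f) (c := c) (R := R) (w := x)
    (by rwa [hR']) (by rwa [hR'])
  have hmean := DiffContOnCl.circleAverage (f := h) (c := c) (R := R) (by rwa [hR'])
  have hhc : h c = f c := by simp [hh, hR.ne']
  rw [doubleLayer_eq_circleAverage hR hfs hxs, ← hhc, ← hmean, ← hcauchy,
    ← Real.circleAverage_fun_add, div_eq_inv_mul, ← smul_eq_mul, ← Real.circleAverage_fun_smul]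
  · refine Real.circleAverage_congr_sphere fun y hy => ?_
    rw [hR'] at hy
    have hyx := hne y hy
    have hyx' : conj (y - x) ≠ 0 := by simpa only [map_ne_zero] using hyx
    have hyc := conj_sub_of_mem_sphere hy
    have hk : conj ((y - c) / (y - x)) = (R : ℂ) ^ 2 / ((R : ℂ) ^ 2 - conj (x - c) * (y - c)) := by
      rw [map_div₀, div_eq_div_iff hyx' (hden y (sphere_subset_closedBall hy)), ← hyc]
      simp only [map_sub]
      ring
    simp only [hh, smul_eq_mul]
    rw [Complex.re_eq_add_conj, hk]
    ring
  · exact ContinuousOn.circleIntegrable hR.le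
      ((ContinuousOn.div (by fun_prop) (by fun_prop) hne).smul hfs)
  · exact ContinuousOn.circleIntegrable hR.le (hd.continuousOn_ball.mono sphere_subset_closedBall)

/-- Now `(y - c) / (y - x)` is itself holomorphic in the disk and vanishes at `c`, so it contributes
`0`. On the circle its conjugate is `1` minus the Cauchy kernel at the reflected point, whence `f c
- f x*`. -/
theorem doubleLayer_of_notMem_closedBall {c x : ℂ} {R : ℝ} (hR : 0 < R) {f : ℂ → ℂ}
    (hf : DiffContOnCl ℂ f (ball c R)) (hx : x ∉ closedBall c R) :
    doubleLayer c R f x = (f c - f (reflect c R x)) / 2 := by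
  have hR' : |R| = R := abs_of_pos hR
  have hxs : x ∉ sphere c R := fun h => hx (sphere_subset_closedBall h)
  have hr := reflect_mem_ball hR hx
  have hrs : reflect c R x ∉ sphere c R := fun h => (mem_ball.1 hr).ne (mem_sphere.1 h)
  have hfs : ContinuousOn f (sphere c R) := hf.continuousOn_ball.mono sphere_subset_closedBall
  have hxc : conj (x - c) ≠ 0 := by
    rw [map_ne_zero, sub_ne_zero]
    rintro rfl
    exact hx (mem_closedBall_self hR.le)
  have hne : ∀ y ∈ closedBall c R, y - x ≠ 0 := fun y hy h => hx (sub_eq_zero.1 h ▸ hy)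
  have hne' : ∀ y ∈ sphere c R, y - reflect c R x ≠ 0 := fun y hy h => hrs (sub_eq_zero.1 h ▸ hy)
  set h : ℂ → ℂ := fun y => (y - c) / (y - x) * f y with hh
  have hd : DiffContOnCl ℂ h (ball c R) := by
    have : DifferentiableOn ℂ (fun y => (y - c) / (y - x)) (closedBall c R) :=
      DifferentiableOn.div (by fun_prop) (by fun_prop) hne
    rw [← closure_ball c hR.ne'] at this
    exact this.diffContOnCl.smul hf
  have hcauchy := DiffContOnCl.circleAverage_smul_div (f := f) (c := c) (R := R)
    (w := reflect c R x) (by rwa [hR']) (by rwa [hR'])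
  have hmean := DiffContOnCl.circleAverage (f := h) (c := c) (R := R) (by rwa [hR'])
  have hmean' := DiffContOnCl.circleAverage (f := f) (c := c) (R := R) (by rwa [hR'])
  have hhc : h c = 0 := by simp [hh]
  have hci : CircleIntegrable h c R :=
    ContinuousOn.circleIntegrable hR.le (hd.continuousOn_ball.mono sphere_subset_closedBall)
  have hcf : CircleIntegrable f c R := ContinuousOn.circleIntegrable hR.le hfs
  have hck : CircleIntegrable (fun y => ((y - c) / (y - reflect c R x)) • f y) c R :=
    ContinuousOn.circleIntegrable hR.le
      ((ContinuousOn.div (by fun_prop) (by fun_prop) hne').smul hfs)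
  have hsum : f c - f (reflect c R x) = h c + (f c - f (reflect c R x)) := by rw [hhc, zero_add]
  rw [doubleLayer_eq_circleAverage hR hfs hxs, hsum, ← hmean, ← hcauchy, ← hmean',
    ← Real.circleAverage_fun_sub hcf hck, ← Real.circleAverage_fun_add hci (hcf.fun_sub hck),
    div_eq_inv_mul, ← smul_eq_mul, ← Real.circleAverage_fun_smul]
  refine Real.circleAverage_congr_sphere fun y hy => ?_
  rw [hR'] at hy
  have hyx' : conj (y - x) ≠ 0 := by
    simpa only [map_ne_zero] using hne y (sphere_subset_closedBall hy)
  have hyr := hne' y hy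
  have hyc := conj_sub_of_mem_sphere hy
  have hk : conj ((y - c) / (y - x)) = 1 - (y - c) / (y - reflect c R x) := by
    rw [one_sub_div hyr, map_div₀, div_eq_div_iff hyx' hyr, reflect, ← hyc]
    have hxc' : conj x - conj c ≠ 0 := by simpa using hxc
    simp only [map_sub]
    field_simp
    ring
  simp only [hh, smul_eq_mul]
  rw [Complex.re_eq_add_conj, hk]
  ring

/-! ### The explicit sequences -/

section Sequences

variable {z : Fin 2 → ℂ} {ρ : Fin 2 → ℝ}

theorem one_sub_one_sub (j : Fin 2) : 1 - (1 - j) = j := sub_sub_cancel 1 j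

theorem norm_sub_other (z : Fin 2 → ℂ) (j : Fin 2) : ‖z j - z (1 - j)‖ = ‖z 0 - z 1‖ := by
  fin_cases j
  · simp
  · simpa using norm_sub_rev (z 1) (z 0)

theorem add_other (ρ : Fin 2 → ℝ) (j : Fin 2) : ρ j + ρ (1 - j) = ρ 0 + ρ 1 := by
  fin_cases j
  · simp
  · simpa using add_comm (ρ 1) (ρ 0)

theorem norm_sub_pos (hρ : ∀ j, 0 < ρ j) (hdisj : ρ 0 + ρ 1 < ‖z 0 - z 1‖) : 0 < ‖z 0 - z 1‖ :=
  (add_pos (hρ 0) (hρ 1)).trans hdisj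

/-- The lower bound is self-propagating: since `ρ_j/|z_0 - z_1| + ρ_k/|z_0 - z_1| < 1`, it gives
`λ_{k,n} > ρ_k/|z_0 - z_1|`, hence `Λ_k/λ_{k,n} < ρ_k/|z_0 - z_1|`. -/
theorem lam_bounds (hρ : ∀ j, 0 < ρ j) (hdisj : ρ 0 + ρ 1 < ‖z 0 - z 1‖) (n : ℕ) (j : Fin 2) :
    1 - ρ (1 - j) / ‖z 0 - z 1‖ < lam z ρ j n ∧ lam z ρ j n ≤ 1 := by
  have hd := norm_sub_pos hρ hdisj
  have hr : ∀ j, 0 < ρ j / ‖z 0 - z 1‖ := fun j => div_pos (hρ j) hd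
  induction n generalizing j with
  | zero => exact ⟨by simpa [lam] using hr (1 - j), le_rfl⟩
  | succ n ih =>
    have h1 := (ih (1 - j)).1
    rw [one_sub_one_sub] at h1
    have hsum : ρ j / ‖z 0 - z 1‖ + ρ (1 - j) / ‖z 0 - z 1‖ < 1 := by
      rw [← add_div, add_other, div_lt_one hd]
      exact hdisj
    have h2 : ρ (1 - j) / ‖z 0 - z 1‖ < lam z ρ (1 - j) n := by linarith
    have hpos := (hr (1 - j)).trans h2
    constructor
    · have : bigLam z ρ (1 - j) / lam z ρ (1 - j) n < ρ (1 - j) / ‖z 0 - z 1‖ := by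
        rw [div_lt_iff₀ hpos, bigLam, sq]
        exact mul_lt_mul_of_pos_left h2 (hr (1 - j))
      rw [lam]
      linarith
    · have : 0 ≤ bigLam z ρ (1 - j) / lam z ρ (1 - j) n := div_nonneg (sq_nonneg _) hpos.le
      rw [lam]
      linarith

theorem lam_mul_norm_ge (hρ : ∀ j, 0 < ρ j) (hdisj : ρ 0 + ρ 1 < ‖z 0 - z 1‖) (n : ℕ) (j : Fin 2) :
    ‖z 0 - z 1‖ - ρ (1 - j) ≤ lam z ρ j n * ‖z 0 - z 1‖ := by
  have hd := norm_sub_pos hρ hdisj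
  have h := mul_le_mul_of_nonneg_right (lam_bounds hρ hdisj n j).1.le hd.le
  rwa [sub_mul, one_mul, div_mul_cancel₀ _ hd.ne'] at h

theorem lam_pos (hρ : ∀ j, 0 < ρ j) (hdisj : ρ 0 + ρ 1 < ‖z 0 - z 1‖) (n : ℕ) (j : Fin 2) :
    0 < lam z ρ j n := by
  have hd := norm_sub_pos hρ hdisj
  have h := lam_mul_norm_ge hρ hdisj n j
  have := add_other ρ j
  have := hρ j
  exact pos_of_mul_pos_left (lt_of_lt_of_le (by linarith) h) hd.le

theorem pt_sub (z : Fin 2 → ℂ) (ρ : Fin 2 → ℝ) (j : Fin 2) (n : ℕ) :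
    pt z ρ j n - z j = (1 - lam z ρ (1 - j) n) * (z (1 - j) - z j) := by
  rw [pt]
  ring

theorem pt_mem_ball (hρ : ∀ j, 0 < ρ j) (hdisj : ρ 0 + ρ 1 < ‖z 0 - z 1‖) (j : Fin 2) (n : ℕ) :
    pt z ρ j n ∈ ball (z j) (ρ j) := by
  have hd := norm_sub_pos hρ hdisj
  obtain ⟨h1, h2⟩ := lam_bounds hρ hdisj n (1 - j)
  rw [one_sub_one_sub] at h1
  have h3 : ‖(1 : ℂ) - lam z ρ (1 - j) n‖ = 1 - lam z ρ (1 - j) n := by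
    rw [← Complex.ofReal_one, ← Complex.ofReal_sub, Complex.norm_real,
      Real.norm_of_nonneg (sub_nonneg.2 h2)]
  rw [mem_ball, dist_eq_norm, pt_sub, norm_mul, h3, norm_sub_rev, norm_sub_other, ← lt_div_iff₀ hd]
  linarith

theorem sub_pt_norm_ge (hρ : ∀ j, 0 < ρ j) (hdisj : ρ 0 + ρ 1 < ‖z 0 - z 1‖) (j : Fin 2) (n : ℕ)
    {x : ℂ} (hx : x ∈ closedBall (z j) (ρ j)) :
    ‖z 0 - z 1‖ - (ρ 0 + ρ 1) ≤ ‖x - pt z ρ (1 - j) n‖ := by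
  have h1 := pt_mem_ball hρ hdisj (1 - j) n
  rw [mem_ball, dist_eq_norm] at h1
  rw [mem_closedBall, dist_eq_norm, norm_sub_rev] at hx
  have h2 : ‖z j - z (1 - j)‖ ≤
      ‖z j - x‖ + ‖x - pt z ρ (1 - j) n‖ + ‖pt z ρ (1 - j) n - z (1 - j)‖ := by
    have := norm_add₃_le (a := z j - x) (b := x - pt z ρ (1 - j) n)
      (c := pt z ρ (1 - j) n - z (1 - j))
    rwa [sub_add_sub_cancel, sub_add_sub_cancel] at this
  rw [norm_sub_other] at h2
  have := add_other ρ j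
  linarith

/-- The defining two-step recursion is this one-step recursion, which swaps the disks and
conjugates, applied twice. Both the decay and the cancellation use this form. -/
theorem kap_succ (z : Fin 2 → ℂ) (ρ : Fin 2 → ℝ) (n : ℕ) (j : Fin 2) :
    kap z ρ j (n + 2) = -((ρ (1 - j) : ℂ) ^ 2 * conj (kap z ρ (1 - j) (n + 1)) /
      ((lam z ρ (1 - j) n : ℂ) ^ 2 * conj (z j - z (1 - j)) ^ 2)) := by
  induction n generalizing j with
  | zero =>
    simp only [kap, lam, one_sub_one_sub, map_mul, map_pow, Complex.conj_ofReal, map_ofNat,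
      Complex.ofReal_one, one_pow, one_mul]
    rw [← neg_sub (z j), map_neg, neg_sq]
    ring
  | succ n ih =>
    have hN : ((bigLam z ρ j * bigLam z ρ (1 - j) : ℝ) : ℂ) =
        (ρ j : ℂ) ^ 2 * (ρ (1 - j) : ℂ) ^ 2 /
          ((z j - z (1 - j)) ^ 2 * conj (z j - z (1 - j)) ^ 2) := by
      rw [← mul_pow (z j - z (1 - j)), Complex.mul_conj, Complex.normSq_eq_norm_sq, norm_sub_other,
        bigLam, bigLam]
      push_cast
      ring
    have h := ih (1 - j)
    rw [one_sub_one_sub] at h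
    rw [h, ← neg_sub (z j)]
    simp only [map_neg, neg_sq, map_div₀, map_mul, map_pow, Complex.conj_ofReal, Complex.conj_conj]
    rw [kap, Complex.ofReal_div, hN]
    push_cast
    generalize z j - z (1 - j) = d
    ring

/-- The `κ_{j,n}` decay geometrically. -/
theorem exists_norm_kap_le (hρ : ∀ j, 0 < ρ j) (hdisj : ρ 0 + ρ 1 < ‖z 0 - z 1‖) :
    ∃ C θ : ℝ, 0 ≤ θ ∧ θ < 1 ∧ ∀ n j, ‖kap z ρ j (n + 1)‖ ≤ C * θ ^ n := by
  have hd := norm_sub_pos hρ hdisj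
  have hgap : ∀ j, ρ (1 - j) < ‖z 0 - z 1‖ - ρ j := fun j => by
    linarith [add_other ρ j]
  -- `η j` bounds the ratio in `kap_succ`, because `λ_{k,n} |z_0 - z_1| ≥ |z_0 - z_1| - ρ_j`;
  -- disjointness makes it less than `1`.
  set η : Fin 2 → ℝ := fun j => (ρ (1 - j) / (‖z 0 - z 1‖ - ρ j)) ^ 2 with hη
  have hη1 : ∀ j, η j < 1 := fun j => by
    have h0 := (hρ (1 - j)).trans (hgap j)
    exact pow_lt_one₀ (div_nonneg (hρ _).le h0.le) ((div_lt_one h0).2 (hgap j)) two_ne_zero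
  refine ⟨2 * ρ 0 ^ 2 + 2 * ρ 1 ^ 2, max (η 0) (η 1), le_max_of_le_left (sq_nonneg _),
    max_lt (hη1 0) (hη1 1), fun n => ?_⟩
  induction n with
  | zero =>
    intro j
    have : ‖kap z ρ j 1‖ = 2 * ρ (1 - j) ^ 2 := by
      simp [kap]
    rw [zero_add, this, pow_zero, mul_one]
    fin_cases j <;> simp <;> positivity
  | succ n ih =>
    intro j
    have h0 := (hρ (1 - j)).trans (hgap j)
    have h1 := lam_mul_norm_ge hρ hdisj n (1 - j)
    rw [one_sub_one_sub] at h1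
    have hle : η j ≤ max (η 0) (η 1) := by fin_cases j <;> simp
    rw [kap_succ, norm_neg, norm_div, norm_mul, norm_mul, norm_pow, norm_pow, norm_pow,
      RCLike.norm_conj, RCLike.norm_conj, Complex.norm_real, Complex.norm_real, norm_sub_other,
      Real.norm_of_nonneg (hρ _).le, Real.norm_of_nonneg (lam_pos hρ hdisj _ _).le, ← mul_pow,
      mul_div_right_comm, ← div_pow, mul_comm (_ ^ 2) ‖_‖, pow_succ (max _ _), ← mul_assoc]
    refine mul_le_mul (ih _) (le_trans ?_ hle) (sq_nonneg _) ((norm_nonneg _).trans (ih j))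
    have := hρ (1 - j)
    have := lam_pos hρ hdisj n (1 - j)
    simp only [hη]
    gcongr

/-! ### Bounds for the densities -/

theorem norm_dens_succ_le (hρ : ∀ j, 0 < ρ j) (hdisj : ρ 0 + ρ 1 < ‖z 0 - z 1‖) (n : ℕ) (j : Fin 2)
    {x : ℂ} (hx : x ∈ closedBall (z j) (ρ j)) :
    ‖dens z ρ j (n + 1) x‖ ≤ 2 / (‖z 0 - z 1‖ - (ρ 0 + ρ 1)) * ‖kap z ρ j (n + 1)‖ := by
  have hδ : 0 < ‖z 0 - z 1‖ - (ρ 0 + ρ 1) := sub_pos.2 hdisj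
  have h1 : ‖kap z ρ j (n + 1) / (x - pt z ρ (1 - j) n)‖ ≤
      ‖kap z ρ j (n + 1)‖ / (‖z 0 - z 1‖ - (ρ 0 + ρ 1)) := by
    rw [norm_div]
    gcongr
    exact sub_pt_norm_ge hρ hdisj j n hx
  have h2 : ‖alp z ρ j (n + 1)‖ ≤ ‖kap z ρ j (n + 1)‖ / (‖z 0 - z 1‖ - (ρ 0 + ρ 1)) := by
    have h3 : ‖z 0 - z 1‖ - (ρ 0 + ρ 1) ≤ lam z ρ j n * ‖z 0 - z 1‖ := by
      linarith [lam_mul_norm_ge hρ hdisj n j, add_other ρ j, hρ j]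
    have h4 : ‖-(1 / 2 : ℂ)‖ ≤ 1 := by norm_num
    rw [alp, norm_mul, norm_div, norm_mul, norm_sub_other, Complex.norm_real,
      Real.norm_of_nonneg (lam_pos hρ hdisj n j).le]
    have hl := lam_pos hρ hdisj n j
    refine (mul_le_of_le_one_left (by positivity) h4).trans ?_
    gcongr
  calc _ ≤ _ := norm_add_le _ _
    _ ≤ _ := add_le_add h1 h2
    _ = _ := by ring

theorem norm_dens_succ_sub_le (hρ : ∀ j, 0 < ρ j) (hdisj : ρ 0 + ρ 1 < ‖z 0 - z 1‖) (n : ℕ)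
    (j : Fin 2) {x y : ℂ} (hx : x ∈ closedBall (z j) (ρ j)) (hy : y ∈ closedBall (z j) (ρ j)) :
    ‖dens z ρ j (n + 1) x - dens z ρ j (n + 1) y‖ ≤
      1 / (‖z 0 - z 1‖ - (ρ 0 + ρ 1)) ^ 2 * ‖kap z ρ j (n + 1)‖ * ‖x - y‖ := by
  have hδ : 0 < ‖z 0 - z 1‖ - (ρ 0 + ρ 1) := sub_pos.2 hdisj
  have hx' := sub_pt_norm_ge hρ hdisj j n hx
  have hy' := sub_pt_norm_ge hρ hdisj j n hy
  have hx0 := norm_pos_iff.1 (hδ.trans_le hx')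
  have hy0 := norm_pos_iff.1 (hδ.trans_le hy')
  have : dens z ρ j (n + 1) x - dens z ρ j (n + 1) y = kap z ρ j (n + 1) * (y - x) /
      ((x - pt z ρ (1 - j) n) * (y - pt z ρ (1 - j) n)) := by
    simp only [dens]
    field_simp
    ring
  rw [this, norm_div, norm_mul, norm_mul, norm_sub_rev y x, mul_assoc, one_div_mul_eq_div, sq]
  gcongr

theorem exists_summable_bound_dens (hρ : ∀ j, 0 < ρ j) (hdisj : ρ 0 + ρ 1 < ‖z 0 - z 1‖) :
    ∃ u : ℕ → ℝ, Summable u ∧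
      (∀ n j, ∀ x ∈ closedBall (z j) (ρ j), ‖dens z ρ j n x‖ ≤ u n) ∧
      ∀ n j, ∀ x ∈ closedBall (z j) (ρ j), ∀ y ∈ closedBall (z j) (ρ j),
        ‖dens z ρ j n x - dens z ρ j n y‖ ≤ u n * ‖x - y‖ := by
  obtain ⟨C, θ, hθ0, hθ1, hκ⟩ := exists_norm_kap_le hρ hdisj
  have hδ : 0 < ‖z 0 - z 1‖ - (ρ 0 + ρ 1) := sub_pos.2 hdisj
  set δ := ‖z 0 - z 1‖ - (ρ 0 + ρ 1)
  have hρ0 := hρ 0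
  have hρ1 := hρ 1
  -- Each value adds a sup bound and a Lipschitz constant, so that one sequence serves for both.
  obtain ⟨u, hu0, hus⟩ : ∃ u : ℕ → ℝ, u 0 = 2 * (ρ 0 + ρ 1) + 2 ∧
      ∀ n, u (n + 1) = (2 / δ + 1 / δ ^ 2) * (C * θ ^ n) :=
    ⟨fun | 0 => _ | n + 1 => _, rfl, fun _ => rfl⟩
  refine ⟨u, (summable_nat_add_iff 1).1 ?_, fun n j x hx => ?_, fun n j x hx y hy => ?_⟩
  · simp only [hus]
    exact ((summable_geometric_of_lt_one hθ0 hθ1).mul_left C).mul_left _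
  · cases n with
    | zero =>
      have h2 : ρ j ≤ ρ 0 + ρ 1 := by linarith [add_other ρ j, hρ (1 - j)]
      rw [mem_closedBall, dist_eq_norm] at hx
      simp only [dens, norm_mul, RCLike.norm_ofNat, hu0]
      linarith
    | succ n =>
      rw [hus]
      refine (norm_dens_succ_le hρ hdisj n j hx).trans ?_
      exact mul_le_mul (le_add_of_nonneg_right (by positivity)) (hκ n j) (norm_nonneg _)
        (by positivity)
  · cases n with
    | zero =>
      simp only [dens, hu0]
      rw [← mul_sub, sub_sub_sub_cancel_right, norm_mul, RCLike.norm_ofNat]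
      gcongr
      linarith
    | succ n =>
      rw [hus]
      refine (norm_dens_succ_sub_le hρ hdisj n j hx hy).trans ?_
      refine mul_le_mul_of_nonneg_right ?_ (norm_nonneg _)
      exact mul_le_mul (le_add_of_nonneg_left (by positivity)) (hκ n j) (norm_nonneg _)
        (by positivity)

theorem diffContOnCl_dens (hρ : ∀ j, 0 < ρ j) (hdisj : ρ 0 + ρ 1 < ‖z 0 - z 1‖) (n : ℕ)
    (j : Fin 2) : DiffContOnCl ℂ (dens z ρ j n) (ball (z j) (ρ j)) := by
  have hδ : 0 < ‖z 0 - z 1‖ - (ρ 0 + ρ 1) := sub_pos.2 hdisj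
  cases n with
  | zero =>
    have : Differentiable ℂ (dens z ρ j 0) := by
      change Differentiable ℂ fun x => 2 * (x - z j)
      fun_prop
    exact this.diffContOnCl
  | succ n =>
    have : DifferentiableOn ℂ (dens z ρ j (n + 1)) (closedBall (z j) (ρ j)) := by
      change DifferentiableOn ℂ
        (fun x => kap z ρ j (n + 1) / (x - pt z ρ (1 - j) n) + alp z ρ j (n + 1)) _
      exact (DifferentiableOn.div (by fun_prop) (by fun_prop) fun x hx =>
        norm_pos_iff.1 (hδ.trans_le (sub_pt_norm_ge hρ hdisj j n hx))).add_const _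
    rw [← closure_ball _ (hρ j).ne'] at this
    exact this.diffContOnCl

/-! ### The cancellation between successive terms -/

theorem notMem_closedBall_other (hdisj : ρ 0 + ρ 1 < ‖z 0 - z 1‖) (j : Fin 2) {x : ℂ}
    (hx : x ∈ ball (z j) (ρ j)) : x ∉ closedBall (z (1 - j)) (ρ (1 - j)) := fun h => by
  rw [mem_ball, dist_eq_norm, norm_sub_rev] at hx
  rw [mem_closedBall, dist_eq_norm] at h
  have h2 := norm_add_le (z j - x) (x - z (1 - j))
  rw [sub_add_sub_cancel, norm_sub_other] at h2
  linarith [add_other ρ j]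

/-- This is what `α_{j,n}` is for: it is minus half the value of the pole term at `z_j`. -/
theorem dens_succ_add_dens_succ_center (z : Fin 2 → ℂ) (ρ : Fin 2 → ℝ) (n : ℕ) (j : Fin 2) (x : ℂ) :
    dens z ρ j (n + 1) x + dens z ρ j (n + 1) (z j) =
      kap z ρ j (n + 1) / (x - pt z ρ (1 - j) n) := by
  have h : z j - pt z ρ (1 - j) n = lam z ρ j n * (z j - z (1 - j)) := by
    rw [pt, one_sub_one_sub]
    ring
  simp only [dens, alp, h]
  ring

/-- Reflection in circle `k` sends the pole `z_{j,n}` to `z_{k,n+1}`, so a simple pole pulled back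
by the reflection is, up to conjugation and a constant, again a simple pole, with coefficient given
by `kap_succ`. For `n = 0` the linear density pulls back to a pole at `z_k`. -/
theorem conj_dens_succ_add (hρ : ∀ j, 0 < ρ j) (hdisj : ρ 0 + ρ 1 < ‖z 0 - z 1‖) (n : ℕ)
    (j : Fin 2) {x : ℂ} (hx : x ∈ ball (z j) (ρ j)) :
    conj (dens z ρ j (n + 1) x + dens z ρ j (n + 1) (z j)) =
      dens z ρ (1 - j) n (reflect (z (1 - j)) (ρ (1 - j)) x) -
        dens z ρ (1 - j) n (z (1 - j)) := by
  have hδ : 0 < ‖z 0 - z 1‖ - (ρ 0 + ρ 1) := sub_pos.2 hdisj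
  have hxc := notMem_closedBall_other hdisj j hx
  have hr := reflect_mem_ball (hρ (1 - j)) hxc
  have hw : conj (x - z (1 - j)) ≠ 0 := by
    rw [map_ne_zero, sub_ne_zero]
    rintro rfl
    exact hxc (mem_closedBall_self (hρ _).le)
  have hp : conj (x - pt z ρ (1 - j) n) ≠ 0 := by
    rw [map_ne_zero]
    exact norm_pos_iff.1 (hδ.trans_le (sub_pt_norm_ge hρ hdisj j n (ball_subset_closedBall hx)))
  rw [dens_succ_add_dens_succ_center, map_div₀]
  cases n with
  | zero =>
    simp [dens, reflect, kap, pt, lam]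
    rw [map_ofNat]
    ring
  | succ n =>
    have hd : z j - z (1 - j) ≠ 0 := by
      rw [← norm_pos_iff, norm_sub_other]
      exact norm_sub_pos hρ hdisj
    have hl : (lam z ρ (1 - j) n : ℂ) ≠ 0 := Complex.ofReal_ne_zero.2 (lam_pos hρ hdisj _ _).ne'
    have hq : reflect (z (1 - j)) (ρ (1 - j)) x - pt z ρ j n ≠ 0 := by
      have := sub_pt_norm_ge hρ hdisj (1 - j) n (ball_subset_closedBall hr)
      rw [one_sub_one_sub] at this
      exact norm_pos_iff.1 (hδ.trans_le this)
    have hcd : conj (z j - z (1 - j)) ≠ 0 := (map_ne_zero _).2 hd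
    -- the conjugate of the distance to the reflected pole
    have hpole : conj (x - pt z ρ (1 - j) (n + 1)) = conj (x - z (1 - j)) -
        (ρ (1 - j) : ℂ) ^ 2 / (lam z ρ (1 - j) n * (z j - z (1 - j))) := by
      have hΛ : (bigLam z ρ (1 - j) : ℂ) =
          (ρ (1 - j) : ℂ) ^ 2 / ((z j - z (1 - j)) * conj (z j - z (1 - j))) := by
        rw [Complex.mul_conj, Complex.normSq_eq_norm_sq, norm_sub_other, bigLam]
        push_cast
        ring
      have h1 : x - pt z ρ (1 - j) (n + 1) = (x - z (1 - j)) -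
          (bigLam z ρ (1 - j) / lam z ρ (1 - j) n : ℝ) * (z j - z (1 - j)) := by
        rw [pt, one_sub_one_sub, lam]
        push_cast
        ring
      rw [h1, map_sub, map_mul, Complex.conj_ofReal, Complex.ofReal_div, hΛ]
      field_simp
    have hrefl : reflect (z (1 - j)) (ρ (1 - j)) x - pt z ρ j n =
        (ρ (1 - j) : ℂ) ^ 2 / conj (x - z (1 - j)) - lam z ρ (1 - j) n * (z j - z (1 - j)) := by
      rw [reflect, pt]
      ring
    have hcen : z (1 - j) - pt z ρ j n = -(lam z ρ (1 - j) n * (z j - z (1 - j))) := by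
      rw [pt]
      ring
    rw [hpole] at hp ⊢
    rw [hrefl] at hq
    have hk : conj (kap z ρ j (n + 1 + 1)) = -((ρ (1 - j) : ℂ) ^ 2 * kap z ρ (1 - j) (n + 1) /
      ((lam z ρ (1 - j) n : ℂ) ^ 2 * (z j - z (1 - j)) ^ 2)) := by
      rw [kap_succ]
      simp only [map_neg, map_div₀, map_mul, map_pow, Complex.conj_ofReal, Complex.conj_conj]
    simp only [dens, one_sub_one_sub, hrefl, hcen, hk]
    generalize conj (x - z (1 - j)) = w at *
    generalize z j - z (1 - j) = d at *
    generalize (lam z ρ (1 - j) n : ℂ) = l at *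
    generalize (ρ (1 - j) : ℂ) = r at *
    have hA : w * l * d - r ^ 2 ≠ 0 := fun h => hp (by field_simp; linear_combination h)
    have e1 : w - r ^ 2 / (l * d) = (w * l * d - r ^ 2) / (l * d) := by field_simp
    have e2 : r ^ 2 / w - l * d = -(w * l * d - r ^ 2) / w := by field_simp; ring
    rw [e1, e2]
    -- Both denominators are multiples of `D`; eliminating `r ^ 2` in its favour leaves a rational
    -- identity with monomial denominators.
    obtain ⟨D, hD⟩ : ∃ D, D = w * l * d - r ^ 2 := ⟨_, rfl⟩
    rw [← hD] at hA ⊢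
    rw [show r ^ 2 = w * l * d - D by rw [hD]; ring]
    field_simp
    ring

end Sequences

/-! ### The limits -/

theorem diffContOnCl_tsum {c : ℂ} {R : ℝ} (hR : 0 < R) {g : ℕ → ℂ → ℂ} {v : ℕ → ℝ}
    (hv : Summable v) (hg : ∀ n, DiffContOnCl ℂ (g n) (ball c R))
    (hb : ∀ n, ∀ x ∈ closedBall c R, ‖g n x‖ ≤ v n) :
    DiffContOnCl ℂ (fun x => ∑' n, g n x) (ball c R) where
  differentiableOn := Complex.differentiableOn_tsum_of_summable_norm hv
    (fun n => (hg n).differentiableOn) isOpen_ball fun n x hx => hb n x (ball_subset_closedBall hx)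
  continuousOn := by
    rw [closure_ball c hR.ne']
    exact continuousOn_tsum (fun n => (hg n).continuousOn_ball) hv hb

end TwoDisks

open TwoDisks in
theorem proposition4p3 (z : Fin 2 → ℂ) (ρ : Fin 2 → ℝ) (hρ : ∀ j, 0 < ρ j)
    (hdisj : ρ 0 + ρ 1 < ‖z 0 - z 1‖) :
    (∀ j n, pt z ρ j n ∈ Metric.ball (z j) (ρ j)) ∧
    ∃ q : Fin 2 → ℂ → ℂ,
      (∀ j, TendstoHHalf (z j) (ρ j)
        (fun N x => ∑ n ∈ Finset.range N,
          (dens z ρ j (2 * n) x + conj (dens z ρ j (2 * n + 1) x)))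
        (q j)) ∧
      (∀ j, ∀ ξ ∈ Metric.ball (z j) (ρ j),
        doubleLayer (z 0) (ρ 0) (q 0) ξ + doubleLayer (z 1) (ρ 1) (q 1) ξ = ξ - z j) := by
  refine ⟨pt_mem_ball hρ hdisj, ?_⟩
  obtain ⟨u, hu, hb, hl⟩ := exists_summable_bound_dens hρ hdisj
  have hu0 : Summable fun n => u (2 * n) :=
    hu.comp_injective fun a b h => by simpa using h
  have hu1 : Summable fun n => u (2 * n + 1) :=
    hu.comp_injective fun a b h => by simpa using h
  refine ⟨fun j x => ∑' n, (dens z ρ j (2 * n) x + conj (dens z ρ j (2 * n + 1) x)),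
    fun j => ?_, fun j ξ hξ => ?_⟩
  · refine tendstoHHalf_tsum (hρ j) (hu0.add hu1) (fun n x hx => ?_) fun n x hx y hy => ?_
    · have hx' := Metric.sphere_subset_closedBall hx
      refine norm_add_le_of_le (hb _ j x hx') ?_
      rw [RCLike.norm_conj]
      exact hb _ j x hx'
    · have hx' := Metric.sphere_subset_closedBall hx
      have hy' := Metric.sphere_subset_closedBall hy
      rw [add_sub_add_comm, ← map_sub, add_mul]
      refine norm_add_le_of_le (hl _ j x hx' y hy') ?_
      rw [RCLike.norm_conj]
      exact hl _ j x hx' y hy'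
  -- The limit density is `H j + conj (K j)` on the circle, with both parts holomorphic in the disk.
  set H : Fin 2 → ℂ → ℂ := fun j x => ∑' n, dens z ρ j (2 * n) x with hH
  set K : Fin 2 → ℂ → ℂ := fun j x => ∑' n, dens z ρ j (2 * n + 1) x with hK
  have hHs : ∀ j, ∀ x ∈ Metric.closedBall (z j) (ρ j), Summable fun n => dens z ρ j (2 * n) x :=
    fun j x hx => .of_norm_bounded hu0 fun n => hb _ j x hx
  have hKs : ∀ j, ∀ x ∈ Metric.closedBall (z j) (ρ j),
      Summable fun n => dens z ρ j (2 * n + 1) x :=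
    fun j x hx => .of_norm_bounded hu1 fun n => hb _ j x hx
  have hHd : ∀ j, DiffContOnCl ℂ (H j) (Metric.ball (z j) (ρ j)) := fun j =>
    diffContOnCl_tsum (hρ j) hu0 (fun n => diffContOnCl_dens hρ hdisj _ j) fun n => hb _ j
  have hKd : ∀ j, DiffContOnCl ℂ (K j) (Metric.ball (z j) (ρ j)) := fun j =>
    diffContOnCl_tsum (hρ j) hu1 (fun n => diffContOnCl_dens hρ hdisj _ j) fun n => hb _ j
  have hcont : ∀ {j} {f : ℂ → ℂ}, DiffContOnCl ℂ f (Metric.ball (z j) (ρ j)) →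
      ContinuousOn f (Metric.sphere (z j) (ρ j)) := fun h =>
    h.continuousOn_ball.mono Metric.sphere_subset_closedBall
  have hsplit : ∀ j, ∀ x ∉ Metric.sphere (z j) (ρ j), doubleLayer (z j) (ρ j)
      (fun x => ∑' n, (dens z ρ j (2 * n) x + conj (dens z ρ j (2 * n + 1) x))) x =
      doubleLayer (z j) (ρ j) (H j) x + conj (doubleLayer (z j) (ρ j) (K j) x) := fun j x hx => by
    rw [← doubleLayer_conj, ← doubleLayer_add (g := fun y => conj (K j y)) (hρ j) (hcont (hHd j))
      (Complex.continuous_conj.comp_continuousOn (hcont (hKd j))) hx]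
    refine doubleLayer_congr (hρ j) fun y hy => ?_
    have hy' := Metric.sphere_subset_closedBall hy
    simp only [hH, hK]
    rw [(hHs j y hy').tsum_add, Complex.conj_tsum]
    exact Complex.summable_conj.2 (hKs j y hy')
  set k := 1 - j with hk
  set r := reflect (z k) (ρ k) ξ with hrdef
  have hξj : ξ ∈ Metric.closedBall (z j) (ρ j) := Metric.ball_subset_closedBall hξ
  have hξk : ξ ∉ Metric.closedBall (z k) (ρ k) := notMem_closedBall_other hdisj j hξ
  have hr : r ∈ Metric.closedBall (z k) (ρ k) :=
    Metric.ball_subset_closedBall (reflect_mem_ball (hρ k) hξk)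
  have hcj : z j ∈ Metric.closedBall (z j) (ρ j) := Metric.mem_closedBall_self (hρ j).le
  have hck : z k ∈ Metric.closedBall (z k) (ρ k) := Metric.mem_closedBall_self (hρ k).le
  have hKH : conj (K j ξ + K j (z j)) = H k r - H k (z k) := by
    simp only [hH, hK]
    rw [← (hKs j ξ hξj).tsum_add (hKs j _ hcj), ← (hHs k r hr).tsum_sub (hHs k _ hck),
      Complex.conj_tsum]
    exact tsum_congr fun n => conj_dens_succ_add hρ hdisj (2 * n) j hξ
  -- Here the indices shift: the even term `2n + 2` is paired with the odd term `2n + 1` on the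
  -- other circle, and the unpaired term `n = 0` yields the right-hand side of the theorem.
  have hHK : H j ξ + H j (z j) = 2 * (ξ - z j) + conj (K k r - K k (z k)) := by
    simp only [hH, hK]
    rw [← (hHs j ξ hξj).tsum_add (hHs j _ hcj), ← (hKs k r hr).tsum_sub (hKs k _ hck),
      Complex.conj_tsum, ((hHs j ξ hξj).add (hHs j _ hcj)).tsum_eq_zero_add]
    congr 1
    · simp [dens]
    · refine tsum_congr fun n => ?_
      rw [← conj_dens_succ_add hρ hdisj (2 * n + 1) j hξ, Complex.conj_conj]
      rfl
  have hsum : ∀ F : Fin 2 → ℂ, F 0 + F 1 = F j + F k := fun F => by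
    rw [hk]
    fin_cases j
    · simp
    · simpa using add_comm (F 0) (F 1)
  rw [hsum fun i => doubleLayer (z i) (ρ i) (fun x => ∑' n, (dens z ρ i (2 * n) x +
      conj (dens z ρ i (2 * n + 1) x))) ξ,
    hsplit j ξ fun h => (Metric.mem_ball.1 hξ).ne (Metric.mem_sphere.1 h),
    hsplit k ξ fun h => hξk (Metric.sphere_subset_closedBall h),
    doubleLayer_of_mem_ball (hρ j) (hHd j) hξ, doubleLayer_of_mem_ball (hρ j) (hKd j) hξ,
    doubleLayer_of_notMem_closedBall (hρ k) (hHd k) hξk,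
    doubleLayer_of_notMem_closedBall (hρ k) (hKd k) hξk, ← hrdef]
  simp only [map_div₀, map_ofNat, map_sub, map_add] at hKH hHK ⊢
  linear_combination hKH / 2 + hHK / 2
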